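/- Let $m \ge 1$ and $n \ge 0$ be integers. A plane partition is a matrix $\pi = (\pi_{ij})_{i,j\ge 1}$ of nonnegative integers with finitely many nonzero entries such that $\pi_{ij} \ge \pi_{i+1,j}$ and $\pi_{ij} \ge \pi_{i,j+1}$ for all $i,j$; its shape is the set $\{(i,j) : \pi_{ij} > 0\}$. A strict tableau with content $[n] = \{1,\ldots,n\}$ is a plane partition all of whose positive entries lie in $[n]$ and in which each $\ell \in [n]$ appears in exactly one column (possibly several times in that column). For integers $\lambda_1 \ge \cdots \ge \lambda_m \ge 0$ let $f_\lambda(n)$ be the number of strict tableaux with content $[n]$ whose shape is $\{(i,j) : 1 \le i \le m,\ 1 \le j \le \lambda_i\}$. Let $w = w_1 \cdots w_n$ be a uniformly random word of length $n$ in the alphabet $[m] = \{1,\ldots,m\}$. For $1 \le i \le m$ let $L_i(w)$ be the length of the longest weakly increasing subsequence of $w$ using only the letters $\{m-i+1,\ldots,m\}$, i.e. the largest $k$ for which there are $1 \le p_1 < \cdots < p_k \le n$ with $m-i+1 \le w_{p_1} \le \cdots \le w_{p_k}$. Theorem. For all integers $\lambda_1 \ge \cdots \ge \lambda_m \ge 0$,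 $$\mathrm{Prob}(L_m = \lambda_1,\ L_{m-1} = \lambda_2,\ \ldots,\ L_1 = \lambda_m) = \frac{f_\lambda(n)}{m^n}.$$ -/

import Mathlib

open MeasureTheory ProbabilityTheory

/-- A plane partition: a matrix of nonnegative integers with finitely many nonzero entries that is
weakly decreasing along rows and along columns.  Rows and columns are numbered from `0`. -/
structure PlanePartition where
  /-- `entry i j` is the entry in row `i` and column `j`. -/
  entry : ℕ → ℕ → ℕ
  finite_support : {c : ℕ × ℕ | entry c.1 c.2 ≠ 0}.Finite
  col_weak : ∀ i j, entry (i + 1) j ≤ entry i j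
  row_weak : ∀ i j, entry i (j + 1) ≤ entry i j

namespace PlanePartition

/-- The shape of a plane partition: the set of positions of its positive entries. -/
def shape (π : PlanePartition) : Set (ℕ × ℕ) := {c | 0 < π.entry c.1 c.2}

/-- `π` is a strict tableau with content `[n] = {1, …, n}`: its positive entries are at most `n`,
and each `ℓ ∈ [n]` occurs in exactly one column of `π` (possibly several times there). -/
def IsStrictTableau (π : PlanePartition) (n : ℕ) : Prop :=
  (∀ i j, π.entry i j ≤ n) ∧ ∀ ℓ ∈ Finset.Icc 1 n, ∃! j, ∃ i, π.entry i j = ℓ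

end PlanePartition

/-- The diagram of `lam = (lam 0, …, lam (m - 1))`: row `i` consists of the cells `(i, j)` with
`j < lam i`. -/
def partitionDiagram {m : ℕ} (lam : Fin m → ℕ) : Set (ℕ × ℕ) :=
  {c | ∃ h : c.1 < m, c.2 < lam ⟨c.1, h⟩}

/-- The set of strict tableaux of shape `lam` with content `[n]`. -/
def strictTableaux {m : ℕ} (lam : Fin m → ℕ) (n : ℕ) : Set PlanePartition :=
  {π | π.shape = partitionDiagram lam ∧ π.IsStrictTableau n}

/-- There are finitely many strict tableaux of given shape and content, so that they can be
counted with `Set.ncard`. -/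
theorem strictTableaux_finite {m : ℕ} (lam : Fin m → ℕ) (n : ℕ) :
    (strictTableaux lam n).Finite := by
  classical
  have key : Function.Injective (fun (π : strictTableaux lam n)
      (c : (i : Fin m) × Fin (lam i)) =>
        (⟨π.1.entry c.1 c.2, Nat.lt_succ_of_le (π.2.2.1 _ _)⟩ : Fin (n + 1))) := by
    rintro ⟨⟨p, hp1, hp2, hp3⟩, hps, hpt⟩ ⟨⟨q, hq1, hq2, hq3⟩, hqs, hqt⟩ h
    have hpq : p = q := by
      funext i j
      by_cases hc : (i, j) ∈ partitionDiagram lam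
      · obtain ⟨hi, hj⟩ := hc
        have := congrFun h ⟨⟨i, hi⟩, ⟨j, hj⟩⟩
        simpa using this
      · have h1 : (i, j) ∉ PlanePartition.shape ⟨p, hp1, hp2, hp3⟩ := by rwa [hps]
        have h2 : (i, j) ∉ PlanePartition.shape ⟨q, hq1, hq2, hq3⟩ := by rwa [hqs]
        simp only [PlanePartition.shape, Set.mem_ofPred_eq, not_lt, Nat.le_zero] at h1 h2
        rw [h1, h2]
    subst hpq
    rfl
  exact Set.finite_coe_iff.mp (Finite.of_injective _ key)

/-- `f_lam(n)`, the number of strict tableaux of shape `lam` with content `[n]`. -/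
noncomputable def numStrictTableaux {m : ℕ} (lam : Fin m → ℕ) (n : ℕ) : ℕ :=
  (strictTableaux lam n).ncard

/-- The weight `P_{gpl,m,n}(lam) = f_lam(n) / m ^ n`. -/
noncomputable def gplProb (m n : ℕ) (lam : Fin m → ℕ) : ℝ :=
  (numStrictTableaux lam n : ℝ) / (m : ℝ) ^ n

open Classical in
/-- `longestWeaklyIncreasing i w` is the length `L_i(w)` of the longest weakly increasing
subsequence of the word `w` that uses only the last `i` letters of the alphabet.  A subsequence is
given by its set `s` of positions.  The alphabet `[m]` is `Fin m`, where `a : Fin m` stands for the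
letter `a + 1`; so the letter `a + 1` is in `{m - i + 1, …, m}` iff `m ≤ a + i`. -/
noncomputable def longestWeaklyIncreasing {m n : ℕ} (i : ℕ) (w : Fin n → Fin m) : ℕ :=
  (Finset.univ.filter fun s : Finset (Fin n) =>
    MonotoneOn w (s : Set (Fin n)) ∧ ∀ p ∈ s, m ≤ (w p : ℕ) + i).sup Finset.card

/-! Read a word from right to left. Let row `k` measure the longest weakly increasing subsequence
with letters `≥ k` (letters numbered from `0`). Prepending `a` leaves the rows below `a` alone. For
`k ≤ a` the new length is the maximum of row `k` and one plus row `a`, because a subsequence that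
starts at `a` continues with letters `≥ a`. Since row `k` is at least row `a`, it grows, by one,
exactly when the two are equal. This is `addCells` (`wordShape_cons`).

The cells added in one step all lie in the column `mu a`. Labelling each cell by the position of the
letter that created it therefore gives a strict tableau. Conversely, removing the cells labelled `1`
from a strict tableau undoes one such step, whose letter is the lowest row with a `1`
(`exists_lower_mem_strictTableaux`). So `recordingTableau` is a bijection from words onto strict
tableaux that carries `wordShape` to the shape, and the counts agree. -/

/-- The row lengths obtained from `mu` by adding one cell to row `a` and to all the rows above it
that have the same length. -/
def addCells {m : ℕ} (a : Fin m) (mu : Fin m → ℕ) (k : Fin m) : ℕ :=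
  if k ≤ a ∧ mu k = mu a then mu k + 1 else mu k

theorem addCells_self {m : ℕ} (a : Fin m) (mu : Fin m → ℕ) : addCells a mu a = mu a + 1 := by
  simp [addCells]

theorem le_addCells {m : ℕ} (a : Fin m) (mu : Fin m → ℕ) (k : Fin m) :
    mu k ≤ addCells a mu k := by
  unfold addCells; split_ifs <;> omega

theorem addCells_antitone {m : ℕ} (a : Fin m) {mu : Fin m → ℕ} (h : Antitone mu) :
    Antitone (addCells a mu) := by
  intro i j hij
  have h1 := h hij
  unfold addCells
  split_ifs with h2 h3 h3
  · omega
  · have : mu i ≠ mu a := fun h4 => h3 ⟨hij.trans h2.1, h4⟩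
    omega
  · omega
  · exact h1

/-- The letter can be read off as the lowest row that grows. -/
theorem addCells_left_injective {m : ℕ} (mu : Fin m → ℕ) {a b : Fin m}
    (h : addCells a mu = addCells b mu) : a = b := by
  have key : ∀ a b : Fin m, addCells a mu = addCells b mu → ¬ a < b := by
    intro a b h hab
    have := congrFun h b
    rw [addCells_self, addCells, if_neg fun h => absurd h.1 (not_le.2 hab)] at this
    omega
  exact le_antisymm (not_lt.1 (key b a h.symm)) (not_lt.1 (key a b h))

section Diagram

variable {m : ℕ}

theorem mem_partitionDiagram_iff {lam : Fin m → ℕ} (i : Fin m) (j : ℕ) :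
    ((i : ℕ), j) ∈ partitionDiagram lam ↔ j < lam i :=
  ⟨fun ⟨_, h⟩ => h, fun h => ⟨i.2, h⟩⟩

theorem partitionDiagram_injective :
    Function.Injective (partitionDiagram : (Fin m → ℕ) → Set (ℕ × ℕ)) := by
  intro lam mu h
  funext i
  have h1 := fun j => (mem_partitionDiagram_iff (lam := lam) i j).symm.trans
    ((Set.ext_iff.1 h _).trans (mem_partitionDiagram_iff i j))
  exact le_antisymm (not_lt.1 fun h2 => lt_irrefl _ ((h1 _).1 h2))
    (not_lt.1 fun h2 => lt_irrefl _ ((h1 _).2 h2))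

theorem partitionDiagram_mono {lam mu : Fin m → ℕ} (h : lam ≤ mu) :
    partitionDiagram lam ⊆ partitionDiagram mu :=
  fun _ ⟨hi, hj⟩ => ⟨hi, hj.trans_le (h _)⟩

theorem partitionDiagram_finite (lam : Fin m → ℕ) : (partitionDiagram lam).Finite := by
  refine (Set.finite_range fun c : (i : Fin m) × Fin (lam i) => ((c.1 : ℕ), (c.2 : ℕ))).subset ?_
  rintro ⟨i, j⟩ ⟨hi, hj⟩
  exact ⟨⟨⟨i, hi⟩, ⟨j, hj⟩⟩, rfl⟩

end Diagram

/-! ### One growth step of a strict tableau, and its inverse -/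

namespace PlanePartition

variable {m n : ℕ}

theorem ext_entry {p q : PlanePartition} (h : ∀ i j, p.entry i j = q.entry i j) : p = q := by
  obtain ⟨p, _, _, _⟩ := p
  obtain ⟨q, _, _, _⟩ := q
  obtain rfl : p = q := funext fun i => funext fun j => h i j
  rfl

theorem entry_antitone_col (p : PlanePartition) (j : ℕ) : Antitone fun i => p.entry i j :=
  antitone_nat_of_succ_le fun i => p.col_weak i j

theorem entry_antitone_row (p : PlanePartition) (i : ℕ) : Antitone (p.entry i) :=
  antitone_nat_of_succ_le fun j => p.row_weak i j

theorem entry_pos_iff {p : PlanePartition} {lam : Fin m → ℕ} (h : p.shape = partitionDiagram lam)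
    (i j : ℕ) : 0 < p.entry i j ↔ (i, j) ∈ partitionDiagram lam :=
  Set.ext_iff.1 h (i, j)

theorem antitone_of_shape_eq {p : PlanePartition} {lam : Fin m → ℕ}
    (h : p.shape = partitionDiagram lam) : Antitone lam := by
  intro i k hik
  by_contra! hlt
  have h1 := (entry_pos_iff h _ _).2 ((mem_partitionDiagram_iff k _).2 hlt)
  have h2 := (entry_pos_iff h _ _).1 (h1.trans_le (p.entry_antitone_col (lam i) hik))
  exact lt_irrefl _ ((mem_partitionDiagram_iff i _).1 h2)

open Classical in
/-- Increase all entries of `p` in the diagram of `lam` by one, and set the others to zero. -/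
noncomputable def raise (p : PlanePartition) (lam : Fin m → ℕ) (h : Antitone lam) :
    PlanePartition where
  entry i j := if (i, j) ∈ partitionDiagram lam then p.entry i j + 1 else 0
  finite_support := (partitionDiagram_finite lam).subset fun c hc => by
    by_contra h
    exact hc (if_neg h)
  col_weak i j := by
    split_ifs with h1 h2
    · exact Nat.succ_le_succ (p.col_weak i j)
    · obtain ⟨hi, hj⟩ := h1
      exact absurd ⟨(Nat.lt_succ_self i).trans hi, hj.trans_le (h (Nat.le_succ i))⟩ h2
    · exact Nat.zero_le _
    · exact le_rfl
  row_weak i j := by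
    split_ifs with h1 h2
    · exact Nat.succ_le_succ (p.row_weak i j)
    · obtain ⟨hi, hj⟩ := h1
      exact absurd ⟨hi, (Nat.lt_succ_self j).trans hj⟩ h2
    · exact Nat.zero_le _
    · exact le_rfl

/-- Decrease all positive entries by one. -/
def lower (p : PlanePartition) : PlanePartition where
  entry i j := p.entry i j - 1
  finite_support := p.finite_support.subset fun c hc h => hc (by simp [h])
  col_weak i j := Nat.sub_le_sub_right (p.col_weak i j) 1
  row_weak i j := Nat.sub_le_sub_right (p.row_weak i j) 1

theorem raise_entry_of_mem (p : PlanePartition) {lam : Fin m → ℕ} (h : Antitone lam) {i j : ℕ}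
    (hij : (i, j) ∈ partitionDiagram lam) : (p.raise lam h).entry i j = p.entry i j + 1 :=
  if_pos hij

theorem raise_entry_of_notMem (p : PlanePartition) {lam : Fin m → ℕ} (h : Antitone lam) {i j : ℕ}
    (hij : (i, j) ∉ partitionDiagram lam) : (p.raise lam h).entry i j = 0 :=
  if_neg hij

theorem raise_shape (p : PlanePartition) {lam : Fin m → ℕ} (h : Antitone lam) :
    (p.raise lam h).shape = partitionDiagram lam := by
  ext ⟨i, j⟩
  change 0 < (p.raise lam h).entry i j ↔ _
  by_cases hij : (i, j) ∈ partitionDiagram lam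
  · simp [raise_entry_of_mem p h hij, hij]
  · simp [raise_entry_of_notMem p h hij, hij]

theorem lower_raise {p : PlanePartition} {lam mu : Fin m → ℕ} (h : Antitone lam)
    (hp : p.shape = partitionDiagram mu) (hle : mu ≤ lam) : (p.raise lam h).lower = p := by
  refine ext_entry fun i j => ?_
  change (p.raise lam h).entry i j - 1 = _
  by_cases hij : (i, j) ∈ partitionDiagram lam
  · simp [raise_entry_of_mem p h hij]
  · have : ¬ 0 < p.entry i j := fun h0 =>
      hij (partitionDiagram_mono hle ((entry_pos_iff hp i j).1 h0))
    rw [raise_entry_of_notMem p h hij]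
    omega

theorem raise_lower {p : PlanePartition} {lam : Fin m → ℕ} (h : Antitone lam)
    (hp : p.shape = partitionDiagram lam) : p.lower.raise lam h = p := by
  refine ext_entry fun i j => ?_
  have hpos := entry_pos_iff hp i j
  by_cases hij : (i, j) ∈ partitionDiagram lam
  · rw [raise_entry_of_mem _ h hij]
    exact Nat.sub_add_cancel (hpos.2 hij)
  · rw [raise_entry_of_notMem _ h hij]
    have := mt hpos.1 hij
    omega

theorem raise_mem_strictTableaux {p : PlanePartition} {mu : Fin m → ℕ} (a : Fin m)
    (hmu : Antitone mu) (hp : p ∈ strictTableaux mu n) :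
    p.raise (addCells a mu) (addCells_antitone a hmu) ∈ strictTableaux (addCells a mu) (n + 1) := by
  obtain ⟨hs, hle, huniq⟩ := hp
  set h := addCells_antitone a hmu
  refine ⟨raise_shape p h, fun i j => ?_, fun l hl => ?_⟩
  · by_cases hij : (i, j) ∈ partitionDiagram (addCells a mu)
    · rw [raise_entry_of_mem p h hij]
      exact Nat.succ_le_succ (hle i j)
    · rw [raise_entry_of_notMem p h hij]
      exact Nat.zero_le _
  have hentry : ∀ l i j, (p.raise _ h).entry i j = l + 1 ↔
      (i, j) ∈ partitionDiagram (addCells a mu) ∧ p.entry i j = l := by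
    intro l i j
    by_cases hij : (i, j) ∈ partitionDiagram (addCells a mu)
    · simp [raise_entry_of_mem p h hij, hij]
    · simp [raise_entry_of_notMem p h hij, hij]
  obtain ⟨hl1, hl2⟩ := Finset.mem_Icc.1 hl
  obtain ⟨l, rfl⟩ := Nat.exists_eq_add_of_le' hl1
  simp only [hentry]
  rcases Nat.eq_zero_or_pos l with rfl | hlpos
  -- The new entries `1` sit where `p` vanishes inside the enlarged diagram, that is, at the ends of
  -- the rows that grew; these all had length `mu a`.
  · refine ⟨mu a, ⟨a, ?_, ?_⟩, ?_⟩
    · rw [mem_partitionDiagram_iff, addCells_self]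
      exact Nat.lt_succ_self _
    · have := mt (entry_pos_iff hs a (mu a)).1 (by simp [mem_partitionDiagram_iff])
      omega
    · rintro j ⟨i, ⟨hi, hj⟩, h0⟩
      have h1 := mt (entry_pos_iff hs i j).2 (by omega)
      have h2 : ¬ j < mu ⟨i, hi⟩ := fun h3 => h1 ⟨hi, h3⟩
      simp only [addCells] at hj
      split_ifs at hj with h3
      · omega
      · omega
  · obtain ⟨j, ⟨i, hij⟩, hj⟩ := huniq l (Finset.mem_Icc.2 ⟨hlpos, Nat.le_of_succ_le_succ hl2⟩)
    refine ⟨j, ⟨i, partitionDiagram_mono (le_addCells a mu) ((entry_pos_iff hs i j).1 ?_), hij⟩,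
      fun j' ⟨i', _, h'⟩ => hj j' ⟨i', h'⟩⟩
    omega

theorem exists_lower_mem_strictTableaux {p : PlanePartition} {lam : Fin m → ℕ}
    (hp : p ∈ strictTableaux lam (n + 1)) :
    ∃ (a : Fin m) (mu : Fin m → ℕ), addCells a mu = lam ∧ p.lower ∈ strictTableaux mu n := by
  classical
  obtain ⟨hs, hle, huniq⟩ := hp
  have hpos : ∀ (i : Fin m) j, 0 < p.entry i j ↔ j < lam i := fun i j =>
    (entry_pos_iff hs i j).trans (mem_partitionDiagram_iff i j)
  have hrow : ∀ i j, 0 < p.entry i j → i < m := fun i j h => ((entry_pos_iff hs i j).1 h).1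
  obtain ⟨c, ⟨r, hr⟩, hc⟩ := huniq 1 (by simp)
  have hone : ∀ i j, p.entry i j = 1 → j = c := fun i j h => hc j ⟨i, h⟩
  -- A `1` ends its row: a positive entry to its right would be another `1`, outside column `c`.
  have hlen : ∀ i : Fin m, p.entry i c = 1 → lam i = c + 1 := by
    intro i hi
    have h1 := (hpos i c).1 (by omega)
    have h2 := p.row_weak i c
    have h3 := mt (hone i (c + 1)) (by omega)
    have h4 := mt (hpos i (c + 1)).2 (by omega)
    omega
  obtain ⟨a, ha, hamax⟩ : ∃ a : Fin m, p.entry a c = 1 ∧ ∀ i : Fin m, p.entry i c = 1 → i ≤ a := by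
    have hne : (Finset.univ.filter fun i : Fin m => p.entry i c = 1).Nonempty :=
      ⟨⟨r, hrow r c (by omega)⟩, by simpa using hr⟩
    exact ⟨Finset.max' _ hne, by simpa using Finset.max'_mem _ hne,
      fun i hi => Finset.le_max' _ _ (by simpa using hi)⟩
  -- `mu` drops the cells labelled `1`, which shortens their rows to length `c`.
  refine ⟨a, fun i => if p.entry i c = 1 then c else lam i, funext fun i => ?_, ?_, ?_, ?_⟩
  · simp only [addCells, if_pos ha]
    by_cases hi : p.entry i c = 1
    · simp [hi, hamax i hi, hlen i hi]
    · rw [if_neg hi, if_neg]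
      -- A row above `a` without a `1` keeps length at least `lam a = c + 1`, so it cannot tie with
      -- row `a` of `mu`, which has length `c`.
      rintro ⟨hia, heq⟩
      have h1 := antitone_of_shape_eq hs hia
      have h2 := hlen a ha
      omega
  · ext ⟨i, j⟩
    change 0 < p.entry i j - 1 ↔ _
    by_cases him : i < m
    · lift i to Fin m using him
      rw [mem_partitionDiagram_iff]
      have h1 := hpos i j
      have h2 := hone i j
      split_ifs with hi
      · have h3 := hlen i hi
        have h4 : c ≤ j → p.entry i j ≤ 1 := fun h => hi ▸ p.entry_antitone_row i h
        omega
      · have h3 : p.entry i j ≠ 1 := fun h => hi (h2 h ▸ h)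
        omega
    · have h1 := mt (hrow i j) him
      exact iff_of_false (by omega) fun h => him h.1
  · intro i j
    have := hle i j
    change p.entry i j - 1 ≤ n
    omega
  · intro l hl
    rw [Finset.mem_Icc] at hl
    have hiff : ∀ i j, p.lower.entry i j = l ↔ p.entry i j = l + 1 := by
      intro i j
      change p.entry i j - 1 = l ↔ _
      omega
    simp only [hiff]
    exact huniq (l + 1) (Finset.mem_Icc.2 (by omega))

end PlanePartition

/-! ### Longest weakly increasing subsequences when a letter is prepended -/

section Words

variable {m n : ℕ}

theorem card_le_longestWeaklyIncreasing {i : ℕ} {w : Fin n → Fin m} {s : Finset (Fin n)}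
    (hs : MonotoneOn w s) (hi : ∀ p ∈ s, m ≤ (w p : ℕ) + i) :
    s.card ≤ longestWeaklyIncreasing i w := by
  classical
  unfold longestWeaklyIncreasing
  exact Finset.le_sup (f := Finset.card) (Finset.mem_filter.2 ⟨Finset.mem_univ s, hs, hi⟩)

theorem exists_card_eq_longestWeaklyIncreasing (i : ℕ) (w : Fin n → Fin m) :
    ∃ s : Finset (Fin n), MonotoneOn w s ∧ (∀ p ∈ s, m ≤ (w p : ℕ) + i) ∧
      s.card = longestWeaklyIncreasing i w := by
  classical
  unfold longestWeaklyIncreasing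
  obtain ⟨s, hs, h⟩ := Finset.exists_mem_eq_sup
    (Finset.univ.filter fun s : Finset (Fin n) =>
      MonotoneOn w (s : Set (Fin n)) ∧ ∀ p ∈ s, m ≤ (w p : ℕ) + i) ⟨∅, by simp [MonotoneOn]⟩ Finset.card
  exact ⟨s, (Finset.mem_filter.1 hs).2.1, (Finset.mem_filter.1 hs).2.2, h.symm⟩

theorem longestWeaklyIncreasing_mono {i i' : ℕ} (h : i ≤ i') (w : Fin n → Fin m) :
    longestWeaklyIncreasing i w ≤ longestWeaklyIncreasing i' w := by
  obtain ⟨s, hs, hi, hcard⟩ := exists_card_eq_longestWeaklyIncreasing i w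
  exact hcard ▸ card_le_longestWeaklyIncreasing hs fun p hp => by have := hi p hp; omega

theorem longestWeaklyIncreasing_le_cons (i : ℕ) (a : Fin m) (w : Fin n → Fin m) :
    longestWeaklyIncreasing i w ≤ longestWeaklyIncreasing i (Fin.cons a w : Fin (n + 1) → Fin m) := by
  obtain ⟨s, hs, hi, hcard⟩ := exists_card_eq_longestWeaklyIncreasing i w
  rw [← hcard, ← Finset.card_map (Fin.succEmb n)]
  refine card_le_longestWeaklyIncreasing ?_ ?_
  · intro p hp q hq hpq
    obtain ⟨p, hps, rfl⟩ := Finset.mem_map.1 hp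
    obtain ⟨q, hqs, rfl⟩ := Finset.mem_map.1 hq
    simpa using hs hps hqs (by simpa using hpq)
  · intro p hp
    obtain ⟨p, hps, rfl⟩ := Finset.mem_map.1 hp
    simpa using hi p hps

/-- The index `m - a` selects the letters `≥ a`, and any weakly increasing choice of these can be
extended by `a` in front. -/
theorem longestWeaklyIncreasing_succ_le_cons {i : ℕ} {a : Fin m} (hia : m ≤ (a : ℕ) + i)
    (w : Fin n → Fin m) :
    longestWeaklyIncreasing (m - a) w + 1 ≤
      longestWeaklyIncreasing i (Fin.cons a w : Fin (n + 1) → Fin m) := by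
  obtain ⟨s, hs, hi, hcard⟩ := exists_card_eq_longestWeaklyIncreasing (m - a) w
  have hge : ∀ p ∈ s, a ≤ w p := fun p hp => by
    have := hi p hp
    have := a.2
    rw [Fin.le_def]
    omega
  have h0 : (0 : Fin (n + 1)) ∉ s.map (Fin.succEmb n) := by simp
  rw [← hcard, ← Finset.card_map (Fin.succEmb n), ← Finset.card_cons h0]
  refine card_le_longestWeaklyIncreasing ?_ ?_
  · intro p hp q hq hpq
    rw [Finset.mem_coe, Finset.mem_cons, Finset.mem_map] at hp hq
    rcases hp with rfl | ⟨p, hp, rfl⟩ <;> rcases hq with rfl | ⟨q, hq, rfl⟩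
    · exact le_rfl
    · simpa using hge q hq
    · exact absurd hpq (by simp)
    · simpa using hs hp hq (by simpa using hpq)
  · intro p hp
    rw [Finset.mem_cons, Finset.mem_map] at hp
    rcases hp with rfl | ⟨p, hp, rfl⟩
    · simpa using hia
    · have h1 := hge p hp
      rw [Fin.le_def] at h1
      simp only [Fin.coe_succEmb, Fin.cons_succ]
      omega

/-- The alternatives are whether an optimal subsequence avoids or uses the prepended letter; if it
uses it, its remaining letters are all `≥ a`. -/
theorem longestWeaklyIncreasing_cons_le (i : ℕ) (a : Fin m) (w : Fin n → Fin m) :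
    longestWeaklyIncreasing i (Fin.cons a w : Fin (n + 1) → Fin m) ≤ longestWeaklyIncreasing i w ∨
      m ≤ (a : ℕ) + i ∧ longestWeaklyIncreasing i (Fin.cons a w : Fin (n + 1) → Fin m) ≤
        longestWeaklyIncreasing (m - a) w + 1 := by
  classical
  obtain ⟨s, hs, hi, hcard⟩ :=
    exists_card_eq_longestWeaklyIncreasing i (Fin.cons a w : Fin (n + 1) → Fin m)
  set t : Finset (Fin n) := Finset.univ.filter fun p => p.succ ∈ s with ht
  have hmem : ∀ {p}, p ∈ t ↔ p.succ ∈ s := by simp [ht]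
  have hmono : MonotoneOn w t := fun p hp q hq hpq => by
    simpa using hs (hmem.1 hp) (hmem.1 hq) (Fin.succ_le_succ_iff.2 hpq)
  have hcount := Fin.card_filter_univ_succ (n := n) (· ∈ s)
  rw [Finset.filter_mem_eq_inter, Finset.univ_inter, ← ht] at hcount
  rw [← hcard, hcount]
  split_ifs with h0
  · refine Or.inr ⟨by simpa using hi 0 h0, Nat.succ_le_succ ?_⟩
    refine card_le_longestWeaklyIncreasing hmono fun p hp => ?_
    have h1 : a ≤ w p := by simpa using hs h0 (hmem.1 hp) (Fin.zero_le _)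
    rw [Fin.le_def] at h1
    omega
  · exact Or.inl (card_le_longestWeaklyIncreasing hmono fun p hp => by
      simpa using hi _ (hmem.1 hp))

/-- The vector `(L_m(w), L_{m-1}(w), …, L_1(w))`. -/
noncomputable def wordShape (w : Fin n → Fin m) (k : Fin m) : ℕ :=
  longestWeaklyIncreasing (m - (k : ℕ)) w

theorem wordShape_antitone (w : Fin n → Fin m) : Antitone (wordShape w) :=
  fun _ _ h => longestWeaklyIncreasing_mono (Nat.sub_le_sub_left h m) w

theorem wordShape_cons (a : Fin m) (w : Fin n → Fin m) :
    wordShape (Fin.cons a w : Fin (n + 1) → Fin m) = addCells a (wordShape w) := by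
  funext k
  have h1 := longestWeaklyIncreasing_cons_le (m - k) a w
  have h2 := longestWeaklyIncreasing_le_cons (m - k) a w
  have h3 := longestWeaklyIncreasing_succ_le_cons (i := m - k) (a := a) (w := w)
  have h4 : k ≤ a → wordShape w a ≤ wordShape w k := fun h => wordShape_antitone w h
  have h5 : m ≤ (a : ℕ) + (m - k) ↔ k ≤ a := by
    rw [Fin.le_def]
    omega
  rw [h5] at h1 h3
  unfold addCells
  unfold wordShape at *
  split_ifs with h
  · have := h3 h.1
    omega
  · by_cases hka : k ≤ a
    · have := h4 hka
      have : ¬ _ = _ := fun h' => h ⟨hka, h'⟩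
      omega
    · have := h1.resolve_right fun h' => hka h'.1
      omega

/-! ### The bijection between words and strict tableaux -/

/-- The tableau that records how the shapes of the suffixes of a word grow. -/
noncomputable def recordingTableau : {n : ℕ} → (Fin n → Fin m) → PlanePartition
  | 0, _ => ⟨fun _ _ => 0, by simp, fun _ _ => le_rfl, fun _ _ => le_rfl⟩
  | _ + 1, w => (recordingTableau (Fin.tail w)).raise
      (addCells (w 0) (wordShape (Fin.tail w))) (addCells_antitone _ (wordShape_antitone _))

theorem recordingTableau_cons (a : Fin m) (w : Fin n → Fin m) :
    recordingTableau (Fin.cons a w : Fin (n + 1) → Fin m) =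
      (recordingTableau w).raise (addCells a (wordShape w))
        (addCells_antitone a (wordShape_antitone w)) := rfl

theorem recordingTableau_mem_strictTableaux (w : Fin n → Fin m) :
    recordingTableau w ∈ strictTableaux (wordShape w) n := by
  induction n with
  | zero =>
    refine ⟨?_, fun _ _ => le_rfl, by simp⟩
    have h0 : ∀ k, wordShape w k = 0 := fun k => by
      obtain ⟨s, -, -, hs⟩ := exists_card_eq_longestWeaklyIncreasing (m - (k : ℕ)) w
      rw [wordShape, ← hs, Finset.eq_empty_of_isEmpty s, Finset.card_empty]
    ext ⟨i, j⟩
    simp [PlanePartition.shape, recordingTableau, partitionDiagram, h0]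
  | succ n ih =>
    cases w using Fin.consCases with | cons a w
    rw [recordingTableau_cons, wordShape_cons]
    exact PlanePartition.raise_mem_strictTableaux a (wordShape_antitone w) (ih w)

/-- Lowering the tableau recovers that of the tail, hence the tail by induction; the growth of the
shape then reveals the first letter. -/
theorem recordingTableau_injective :
    Function.Injective (recordingTableau : (Fin n → Fin m) → PlanePartition) := by
  induction n with
  | zero => exact Function.injective_of_subsingleton _
  | succ n ih =>
    intro u v h
    have hshape : wordShape u = wordShape v := partitionDiagram_injective <| by
      rw [← (recordingTableau_mem_strictTableaux u).1, h,
        (recordingTableau_mem_strictTableaux v).1]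
    have hlower : ∀ w : Fin (n + 1) → Fin m,
        (recordingTableau w).lower = recordingTableau (Fin.tail w) := fun w =>
      PlanePartition.lower_raise _ (recordingTableau_mem_strictTableaux (Fin.tail w)).1
        (le_addCells _ _)
    have htail : Fin.tail u = Fin.tail v := ih (by rw [← hlower, ← hlower, h])
    rw [← Fin.cons_self_tail u, ← Fin.cons_self_tail v, wordShape_cons, wordShape_cons,
      htail] at hshape
    rw [← Fin.cons_self_tail u, ← Fin.cons_self_tail v, htail, addCells_left_injective _ hshape]

theorem exists_recordingTableau_eq {p : PlanePartition} {lam : Fin m → ℕ}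
    (hp : p ∈ strictTableaux lam n) : ∃ w : Fin n → Fin m, recordingTableau w = p := by
  induction n generalizing p lam with
  | zero =>
    exact ⟨Fin.elim0, PlanePartition.ext_entry fun i j => (Nat.le_zero.1 (hp.2.1 i j)).symm⟩
  | succ n ih =>
    obtain ⟨a, mu, rfl, hmem⟩ := PlanePartition.exists_lower_mem_strictTableaux hp
    obtain ⟨w, hw⟩ := ih hmem
    -- The induction yields a word for the lowered tableau, whose shape forces the word's row
    -- lengths to be `mu`.
    have hmu : wordShape w = mu := partitionDiagram_injective <| by
      rw [← (recordingTableau_mem_strictTableaux w).1, hw, hmem.1]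
    subst hmu
    refine ⟨Fin.cons a w, ?_⟩
    rw [recordingTableau_cons, hw]
    exact PlanePartition.raise_lower _ hp.1

theorem numStrictTableaux_eq_ncard (lam : Fin m → ℕ) :
    numStrictTableaux lam n = {w : Fin n → Fin m | wordShape w = lam}.ncard := by
  rw [numStrictTableaux, ← Set.ncard_image_of_injective _ recordingTableau_injective]
  congr 1
  ext p
  constructor
  · intro hp
    obtain ⟨w, rfl⟩ := exists_recordingTableau_eq hp
    exact ⟨w, partitionDiagram_injective
      ((recordingTableau_mem_strictTableaux w).1.symm.trans hp.1), rfl⟩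
  · rintro ⟨w, rfl, rfl⟩
    exact recordingTableau_mem_strictTableaux w

end Words

/-! ### From counting to probability -/

theorem uniformOn_univ_real {Ω : Type*} [Fintype Ω] [MeasurableSpace Ω]
    [MeasurableSingletonClass Ω] (s : Set Ω) :
    (uniformOn (Set.univ : Set Ω)).real s = (s.ncard : ℝ) / Fintype.card Ω := by
  rw [measureReal_def, uniformOn_univ, Measure.count_apply_finite s s.toFinite,
    ENNReal.toReal_div, ENNReal.toReal_natCast, ENNReal.toReal_natCast,
    Set.ncard_eq_toFinset_card s s.toFinite]

theorem mainTheorem9 (m n : ℕ) (hm : 1 ≤ m) (lam : Fin m → ℕ) (hlam : Antitone lam) :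
    (uniformOn (Set.univ : Set (Fin n → Fin m))).real
        {w | ∀ k : Fin m, longestWeaklyIncreasing (m - (k : ℕ)) w = lam k} =
      gplProb m n lam := by
  rw [uniformOn_univ_real, gplProb, numStrictTableaux_eq_ncard]
  simp [wordShape, funext_iff]
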